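/- Let $n\ge 0$, let $A$ be an integer $n\times n$ matrix all of whose complex eigenvalues have modulus greater than $1$, and let $D\subset\mathbb{Z}^n$ be finite and nonempty. Let $C\subset\mathbb{Z}^n$ be a finite set containing exactly one element of every coset in $\mathbb{Z}^n/A\mathbb{Z}^n$, and let $K\subset\mathbb{Z}^n$ be any finite set with $D\cup C\subseteq K$. Let $\Gamma$ be the directed labeled graph with vertex set $\mathbb{Z}^n$ that has an edge from $u$ to $v$ labeled $(x,y)$, for $x,y\in K$, exactly when $u+x=y+Av$. Let $\mathcal{N}$ be the subgraph of $\Gamma$ spanned by all vertices that lie on a directed cycle (loops included) or can be reached along a directed path from a vertex on a directed cycle. Let $\mathcal{N}_D$ be the graph with the same vertices as $\mathcal{N}$ obtained by keeping only the edges whose label $(x,y)$ lies in $C\times D$ and replacing each such label by $x$. Let $C^{-\omega}$ be the space of left-infinite sequences $\ldots x_2x_1$ with $x_i\in C$, with the product topology of the discrete topologies, let $\mu$ be the product measure on $C^{-\omega}$ of the uniform probability measures on $C$, and for a vertex $v$ let $F_v\subset C^{-\omega}$ be the set of all label sequences $\ldots x_2x_1$ of left-infinite paths $\cdots\xrightarrow{x_3}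 w_2\xrightarrow{x_2}w_1\xrightarrow{x_1}w_0=v$ in $\mathcal{N}_D$ that end at $v$. Then there is a unique nonempty compact set $T=T(A,D)\subset\mathbb{R}^n$ with $A(T)=\bigcup_{d\in D}(T+d)$, the graph $\mathcal{N}$ has finitely many vertices, every set $F_v$ is closed in $C^{-\omega}$, and the Lebesgue measure of $T$ is $$\lambda(T)=\sum_{v\in\mathcal{N}_D}\mu(F_v).$$ -/

import Mathlib

open MeasureTheory
open scoped Matrix

namespace SelfAffine

/-- An integer square matrix is expanding if all its complex eigenvalues have modulus `> 1`. -/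
def IsExpanding {n : ℕ} (A : Matrix (Fin n) (Fin n) ℤ) : Prop :=
  ∀ z : ℂ, Module.End.HasEigenvalue (Matrix.toLin' (A.map (Int.cast : ℤ → ℂ))) z → 1 < ‖z‖

/-- The embedding of `ℤⁿ` into `ℝⁿ`. -/
def toReal {n : ℕ} (z : Fin n → ℤ) : Fin n → ℝ := fun i => (z i : ℝ)

/-- `T` is a nonempty compact subset of `ℝⁿ` with `A(T) = ⋃_{d ∈ D} (T + d)`. -/
structure IsSelfAffineSet {n : ℕ} (A : Matrix (Fin n) (Fin n) ℤ) (D : Finset (Fin n → ℤ))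
    (T : Set (Fin n → ℝ)) : Prop where
  nonempty : T.Nonempty
  isCompact : IsCompact T
  image_eq : (fun t => A.map (Int.cast : ℤ → ℝ) *ᵥ t) '' T =
    ⋃ d ∈ D, (fun t => t + toReal d) '' T

/-- `C` contains exactly one element of every coset of `Aℤⁿ` in `ℤⁿ`. -/
def IsCosetTransversal {n : ℕ} (A : Matrix (Fin n) (Fin n) ℤ) (C : Finset (Fin n → ℤ)) : Prop :=
  ∀ z : Fin n → ℤ, ∃! c : Fin n → ℤ, c ∈ C ∧ ∃ w : Fin n → ℤ, z = c + A *ᵥ w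

/-- There is an edge `u → v` labelled `(x, y)` in the graph `Γ(A, K)`, whose vertex set
is `ℤⁿ`. -/
def IsEdge {n : ℕ} (A : Matrix (Fin n) (Fin n) ℤ) (K : Finset (Fin n → ℤ))
    (u x y v : Fin n → ℤ) : Prop :=
  x ∈ K ∧ y ∈ K ∧ u + x = y + A *ᵥ v

/-- There is an edge from `u` to `v` in `Γ(A, K)`. -/
def Adj {n : ℕ} (A : Matrix (Fin n) (Fin n) ℤ) (K : Finset (Fin n → ℤ))
    (u v : Fin n → ℤ) : Prop :=
  ∃ x y : Fin n → ℤ, IsEdge A K u x y v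

/-- The vertex set of the nucleus of `Γ(A, K)`: all vertices that lie on a directed cycle or can
be reached along a directed path from a vertex on a directed cycle (loops are cycles). -/
def nucleus {n : ℕ} (A : Matrix (Fin n) (Fin n) ℤ) (K : Finset (Fin n → ℤ)) :
    Set (Fin n → ℤ) :=
  {v | ∃ u, Relation.TransGen (Adj A K) u u ∧ Relation.ReflTransGen (Adj A K) u v}

/-- There is an edge `u → v` labelled `x` in the graph `𝒩_D`: the vertices are those of the
nucleus, only edges with label `(x, y) ∈ C × D` are kept, and `(x, y)` is replaced by `x`. -/
def IsEdgeD {n : ℕ} (A : Matrix (Fin n) (Fin n) ℤ) (K C D : Finset (Fin n → ℤ))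
    (u x v : Fin n → ℤ) : Prop :=
  u ∈ nucleus A K ∧ v ∈ nucleus A K ∧ x ∈ C ∧ ∃ y ∈ D, IsEdge A K u x y v

/-- The set `F_v` of left-infinite sequences `… x₂ x₁` over `C` read along left-infinite paths
`… → w₂ → w₁ → w₀ = v` of `𝒩_D`. A left-infinite sequence `… x₂ x₁` is coded by
`x : ℕ → C` with `x k` in the role of `x_{k+1}`, the label of the edge `w_{k+1} → w_k`. -/
def pathSet {n : ℕ} (A : Matrix (Fin n) (Fin n) ℤ) (K C D : Finset (Fin n → ℤ))
    (v : Fin n → ℤ) : Set (ℕ → C) :=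
  {x | ∃ w : ℕ → (Fin n → ℤ), w 0 = v ∧ ∀ k, IsEdgeD A K C D (w (k + 1)) (x k) (w k)}

/-- The uniform Bernoulli measure on the space of left-infinite sequences over `C`. -/
noncomputable def bernoulliMeasure {n : ℕ} (C : Finset (Fin n → ℤ)) : Measure (ℕ → C) :=
  Measure.infinitePi fun _ : ℕ => ProbabilityTheory.uniformOn (Set.univ : Set C)

end SelfAffine

/-!
The proof identifies every term of the sum with the mass of a translate of `T`, and then recognises
the sum of all those masses as Lebesgue measure.

Put `M = A⁻¹`. Since `A` is expanding, the operator norms of the powers of `M` are summable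
(`IsExpanding.exists_summable_bound`, from the spectral radius formula), so a digit sequence
`x₀x₁x₂…` has a value `∑ M ^ (k + 1) x_k`, depending continuously on the sequence. Iterating
`A(T) = T + D` in both directions shows that `T` is the set of values of sequences over `D`
(`IsSelfAffineSet.eq_range`).

Along a left-infinite path the edge equation reads `w_k = M (w_{k+1} + x_k - y_k)`. A path with
finitely many vertices is bounded, so `w_0 = ∑ M ^ (k + 1) x_k - ∑ M ^ (k + 1) y_k`; this bounds the
nucleus, each of whose vertices ends such a path. Conversely, if an integer vector `v` is a
difference of two such values, then the edge equations generate an integral and bounded path ending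
at `v`, which lies in the nucleus by the pigeonhole principle. Hence `F_v` is the set of sequences
over `C` with value in `T + v` (`mem_pathSet_iff`), which is closed. For `v` outside the nucleus
`F_v` is empty.

Let `ν` be the distribution of the value of a random sequence over `C`, so that
`μ(F_v) = ν(T + v)`, and let `Λ` be the sum of all integer translates of `ν`, so that
`∑_v μ(F_v) = Λ(T)`. Prepending a letter shows that `ν` is the average of its images under
`t ↦ M (t + c)`, `c ∈ C`. As every integer vector is uniquely of the form `A v - c`, this gives
`M_* Λ = |C| • Λ` (`map_inv_mulVec_latticeSum`). Invariance of `Λ` under `ℤⁿ` therefore propagates to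
all `M ^ k ℤⁿ`, whose union is dense, so `Λ` is translation-invariant
(`isAddLeftInvariant_of_dense`). It gives mass `1` to the unit cube, so it is Lebesgue measure
(`latticeSum_digitMeasure_eq_volume`).
-/

namespace SelfAffine

/-! ### Contraction by the inverse of an expanding matrix -/

section Contraction

attribute [local instance] Matrix.linftyOpNormedRing Matrix.linftyOpNormedAlgebra

/-- The root test, applied to Gelfand's formula for the spectral radius. -/
theorem summable_norm_pow_of_spectralRadius_lt_one {R : Type*} [NormedRing R]
    [NormedAlgebra ℂ R] [CompleteSpace R] {a : R} (ha : spectralRadius ℂ a < 1) :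
    Summable fun k : ℕ => ‖a ^ k‖ := by
  obtain ⟨r, hr, hr1⟩ := exists_between ha
  have hlim := spectrum.pow_nnnorm_pow_one_div_tendsto_nhds_spectralRadius a
  have hev := (hlim.eventually_lt_const hr).and (Filter.eventually_gt_atTop 0)
  have hr_top : r ≠ ⊤ := (hr1.trans ENNReal.one_lt_top).ne
  lift r to NNReal using hr_top
  have hr1' : (r : ℝ) < 1 := by exact_mod_cast hr1
  refine (summable_geometric_of_lt_one r.2 hr1').of_norm_bounded_eventually_nat ?_
  filter_upwards [hev] with k hk
  obtain ⟨hk, hk0⟩ := hk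
  have hk' : (0 : ℝ) < k := by exact_mod_cast hk0
  have h : (‖a ^ k‖₊ : ENNReal) ≤ (r : ENNReal) ^ (k : ℝ) := by
    have := ENNReal.rpow_le_rpow hk.le hk'.le
    rwa [← ENNReal.rpow_mul, one_div_mul_cancel hk'.ne', ENNReal.rpow_one] at this
  rw [ENNReal.rpow_natCast] at h
  have h2 : ‖a ^ k‖₊ ≤ r ^ k := by exact_mod_cast h
  simpa using (show ‖a ^ k‖ ≤ (r : ℝ) ^ k from by exact_mod_cast h2)

variable {n : ℕ} {A : Matrix (Fin n) (Fin n) ℤ}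

theorem IsExpanding.isUnit_complex (hA : IsExpanding A) :
    IsUnit (A.map (Int.cast : ℤ → ℂ)) := by
  by_contra h
  have h0 : (0 : ℂ) ∈ spectrum ℂ (A.map (Int.cast : ℤ → ℂ)) := spectrum.zero_mem ℂ h
  rw [← Matrix.spectrum_toLin', ← Module.End.hasEigenvalue_iff_mem_spectrum] at h0
  have := hA 0 h0
  simp at this
  linarith

theorem IsExpanding.det_ne_zero (hA : IsExpanding A) : A.det ≠ 0 := by
  have h := hA.isUnit_complex
  rw [Matrix.isUnit_iff_isUnit_det] at h
  intro h0
  have : (A.map (Int.cast : ℤ → ℂ)).det = ((A.det : ℤ) : ℂ) :=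
    ((Int.castRingHom ℂ).map_det A).symm
  rw [this, h0] at h
  simp at h

theorem IsExpanding.isUnit_real (hA : IsExpanding A) :
    IsUnit (A.map (Int.cast : ℤ → ℝ)).det := by
  have : (A.map (Int.cast : ℤ → ℝ)).det = ((A.det : ℤ) : ℝ) :=
    ((Int.castRingHom ℝ).map_det A).symm
  rw [this, isUnit_iff_ne_zero]
  exact_mod_cast hA.det_ne_zero

theorem IsExpanding.spectralRadius_inv_lt_one (hA : IsExpanding A) :
    spectralRadius ℂ (A.map (Int.cast : ℤ → ℂ))⁻¹ < 1 := by
  rcases subsingleton_or_nontrivial (Matrix (Fin n) (Fin n) ℂ) with hs | hs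
  · rw [Subsingleton.elim (A.map (Int.cast : ℤ → ℂ))⁻¹ 0, spectrum.spectralRadius_zero]
    exact one_pos
  obtain ⟨u, hu⟩ := hA.isUnit_complex
  refine spectrum.spectralRadius_lt_of_forall_lt (r := 1) _ fun z hz => ?_
  rw [← hu, ← Matrix.coe_units_inv] at hz
  have hz0 : z ≠ 0 := spectrum.ne_zero_of_mem_of_unit hz
  have hz' : z⁻¹ ∈ spectrum ℂ (A.map (Int.cast : ℤ → ℂ)) := by
    rw [← hu]
    have := (spectrum.inv_mem_iff (R := ℂ) (r := Units.mk0 z hz0) (a := u⁻¹)).1 hz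
    simpa using this
  rw [← Matrix.spectrum_toLin', ← Module.End.hasEigenvalue_iff_mem_spectrum] at hz'
  have h1 := hA _ hz'
  rw [norm_inv] at h1
  have : ‖z‖ < 1 := (one_lt_inv₀ (norm_pos_iff.2 hz0)).1 h1
  exact_mod_cast this

/-- The powers of the inverse of an expanding matrix have summable operator norms. -/
theorem IsExpanding.exists_summable_bound (hA : IsExpanding A) :
    ∃ r : ℕ → ℝ, Summable r ∧ ∀ k (v : Fin n → ℝ),
      ‖(A.map (Int.cast : ℤ → ℝ))⁻¹ ^ k *ᵥ v‖ ≤ r k * ‖v‖ := by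
  refine ⟨fun k => ‖(A.map (Int.cast : ℤ → ℂ))⁻¹ ^ k‖,
    summable_norm_pow_of_spectralRadius_lt_one hA.spectralRadius_inv_lt_one, fun k v => ?_⟩
  have hinv : (A.map (Int.cast : ℤ → ℂ))⁻¹ =
      (A.map (Int.cast : ℤ → ℝ))⁻¹.map (algebraMap ℝ ℂ) := by
    refine Matrix.inv_eq_left_inv ?_
    have h1 : A.map (Int.cast : ℤ → ℂ) = (A.map (Int.cast : ℤ → ℝ)).map (algebraMap ℝ ℂ) := by
      ext; simp
    rw [h1, ← Matrix.map_mul, Matrix.nonsing_inv_mul _ hA.isUnit_real]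
    exact Matrix.map_one _ (map_zero _) (map_one _)
  have hpow : (A.map (Int.cast : ℤ → ℂ))⁻¹ ^ k =
      ((A.map (Int.cast : ℤ → ℝ))⁻¹ ^ k).map (algebraMap ℝ ℂ) := by
    rw [hinv, Matrix.map_pow]
  have hnorm : ‖(A.map (Int.cast : ℤ → ℂ))⁻¹ ^ k‖ = ‖(A.map (Int.cast : ℤ → ℝ))⁻¹ ^ k‖ := by
    rw [hpow, Matrix.linfty_opNorm_def, Matrix.linfty_opNorm_def]
    simp
  beta_reduce
  rw [hnorm]
  exact Matrix.linfty_opNorm_mulVec _ _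

end Contraction

/-! ### Radix expansions with bounded digits -/

/-- A real square matrix whose powers have summable operator norms. -/
def IsPowSummable {n : ℕ} (M : Matrix (Fin n) (Fin n) ℝ) : Prop :=
  ∃ r : ℕ → ℝ, Summable r ∧ ∀ k (v : Fin n → ℝ), ‖M ^ k *ᵥ v‖ ≤ r k * ‖v‖

/-- The point `∑_{k ≥ 0} M ^ (k + 1) y_k`, which for `M = A⁻¹` is the value of the radix expansion
`0.y₀y₁y₂…` in base `A`. -/
noncomputable def expansion {n : ℕ} (M : Matrix (Fin n) (Fin n) ℝ) (y : ℕ → Fin n → ℝ) :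
    Fin n → ℝ :=
  ∑' k, M ^ (k + 1) *ᵥ y k

section Expansion

variable {n : ℕ} {M : Matrix (Fin n) (Fin n) ℝ}

namespace IsPowSummable

theorem exists_nonneg_bound (hM : IsPowSummable M) :
    ∃ r : ℕ → ℝ, Summable r ∧ (∀ k, 0 ≤ r k) ∧
      ∀ k (v : Fin n → ℝ), ‖M ^ k *ᵥ v‖ ≤ r k * ‖v‖ := by
  obtain ⟨r, hr, h⟩ := hM
  exact ⟨fun k => |r k|, hr.abs, fun k => abs_nonneg _, fun k v => (h k v).trans
    (mul_le_mul_of_nonneg_right (le_abs_self _) (norm_nonneg _))⟩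

theorem summable (hM : IsPowSummable M) {y : ℕ → Fin n → ℝ} {R : ℝ} (hy : ∀ k, ‖y k‖ ≤ R) :
    Summable fun k => M ^ (k + 1) *ᵥ y k := by
  obtain ⟨r, hr, hr0, h⟩ := hM.exists_nonneg_bound
  refine Summable.of_norm_bounded (((summable_nat_add_iff 1).2 hr).mul_right R) fun k => ?_
  exact (h _ _).trans (mul_le_mul_of_nonneg_left (hy k) (hr0 _))

theorem exists_norm_expansion_le (hM : IsPowSummable M) (R : ℝ) :
    ∃ R' : ℝ, ∀ y : ℕ → Fin n → ℝ, (∀ k, ‖y k‖ ≤ R) → ‖expansion M y‖ ≤ R' := by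
  obtain ⟨r, hr, hr0, h⟩ := hM.exists_nonneg_bound
  refine ⟨∑' k, r (k + 1) * R, fun y hy => ?_⟩
  refine tsum_of_norm_bounded (((summable_nat_add_iff 1).2 hr).mul_right R).hasSum fun k => ?_
  exact (h _ _).trans (mul_le_mul_of_nonneg_left (hy k) (hr0 _))

theorem expansion_eq_mulVec (hM : IsPowSummable M) {y : ℕ → Fin n → ℝ} {R : ℝ}
    (hy : ∀ k, ‖y k‖ ≤ R) :
    expansion M y = M *ᵥ (y 0 + expansion M fun k => y (k + 1)) := by
  have hs := hM.summable (y := fun k => y (k + 1)) (fun k => hy (k + 1))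
  have h1 : M *ᵥ expansion M (fun k => y (k + 1)) =
      ∑' k, M *ᵥ (M ^ (k + 1) *ᵥ y (k + 1)) :=
    (M.mulVecLin.toContinuousLinearMap).map_tsum hs
  rw [Matrix.mulVec_add, h1, expansion, (hM.summable hy).tsum_eq_zero_add]
  simp only [Matrix.mulVec_mulVec, ← pow_succ']
  simp

theorem expansion_sub (hM : IsPowSummable M) {x y : ℕ → Fin n → ℝ} {R : ℝ}
    (hx : ∀ k, ‖x k‖ ≤ R) (hy : ∀ k, ‖y k‖ ≤ R) :
    expansion M (fun k => x k - y k) = expansion M x - expansion M y := by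
  rw [expansion, expansion, expansion, ← (hM.summable hx).tsum_sub (hM.summable hy)]
  simp only [Matrix.mulVec_sub]

theorem tendsto_pow_mulVec (hM : IsPowSummable M) {e : ℕ → Fin n → ℝ} {R : ℝ}
    (he : ∀ k, ‖e k‖ ≤ R) :
    Filter.Tendsto (fun k => M ^ k *ᵥ e k) Filter.atTop (nhds 0) := by
  obtain ⟨r, hr, hr0, h⟩ := hM.exists_nonneg_bound
  refine squeeze_zero_norm (fun k => (h k (e k)).trans
    (mul_le_mul_of_nonneg_left (he k) (hr0 k))) ?_
  simpa using hr.tendsto_atTop_zero.mul_const R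

/-- A bounded orbit of the recursion `t_k = M (y_k + t_{k+1})` is determined by its digits. -/
theorem eq_expansion (hM : IsPowSummable M) {t y : ℕ → Fin n → ℝ} {R : ℝ}
    (hy : ∀ k, ‖y k‖ ≤ R) (ht : ∀ k, ‖t k‖ ≤ R) (h : ∀ k, t k = M *ᵥ (y k + t (k + 1))) :
    t 0 = expansion M y := by
  obtain ⟨R', hR'⟩ := hM.exists_norm_expansion_le R
  have key : ∀ k, t 0 - expansion M y = M ^ k *ᵥ (t k - expansion M fun j => y (j + k)) := by
    intro k
    induction k with
    | zero => simp
    | succ k ih =>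
      rw [ih, h k, hM.expansion_eq_mulVec (y := fun j => y (j + k)) (fun j => hy _),
        ← Matrix.mulVec_sub, Matrix.mulVec_mulVec, ← pow_succ]
      simp only [zero_add, add_sub_add_left_eq_sub, add_right_comm _ 1 k, add_assoc]
  have hlim := hM.tendsto_pow_mulVec (e := fun k => t k - expansion M fun j => y (j + k))
    (R := R + R') fun k => (norm_sub_le _ _).trans (add_le_add (ht k) (hR' _ fun j => hy _))
  rw [← sub_eq_zero]
  refine tendsto_nhds_unique ?_ hlim
  simp only [← key]
  exact tendsto_const_nhds

end IsPowSummable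

/-! ### The self-affine set of a digit set -/

theorem exists_norm_toReal_le (D : Finset (Fin n → ℤ)) : ∃ R : ℝ, ∀ z ∈ D, ‖toReal z‖ ≤ R := by
  obtain ⟨R, hR⟩ := (D.finite_toSet.image fun z => ‖toReal z‖).bddAbove
  exact ⟨R, fun z hz => hR ⟨z, hz, rfl⟩⟩

/-- The value of the radix expansion with integer digits `x₀x₁x₂…` from a finite set. -/
noncomputable def digitPoint (M : Matrix (Fin n) (Fin n) ℝ) (D : Finset (Fin n → ℤ)) (x : ℕ → D) :
    Fin n → ℝ :=
  expansion M fun k => toReal (x k : Fin n → ℤ)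

variable {D : Finset (Fin n → ℤ)}

theorem IsPowSummable.continuous_digitPoint (hM : IsPowSummable M) :
    Continuous (digitPoint M D) := by
  obtain ⟨R, hR⟩ := exists_norm_toReal_le D
  obtain ⟨r, hr, hr0, h⟩ := hM.exists_nonneg_bound
  refine continuous_tsum (u := fun k => r (k + 1) * R) (fun k => ?_)
    (((summable_nat_add_iff 1).2 hr).mul_right R) fun k x =>
      (h _ _).trans (mul_le_mul_of_nonneg_left (hR _ (x k).2) (hr0 _))
  have h1 : Continuous fun d : D => M ^ (k + 1) *ᵥ toReal (d : Fin n → ℤ) :=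
    continuous_of_discreteTopology
  exact h1.comp (continuous_apply k)

theorem IsPowSummable.digitPoint_eq (hM : IsPowSummable M) (x : ℕ → D) :
    digitPoint M D x =
      M *ᵥ (toReal (x 0 : Fin n → ℤ) + digitPoint M D fun k => x (k + 1)) := by
  obtain ⟨R, hR⟩ := exists_norm_toReal_le D
  exact hM.expansion_eq_mulVec fun k => hR _ (x k).2

theorem IsPowSummable.exists_norm_digitPoint_le (hM : IsPowSummable M) :
    ∃ R : ℝ, ∀ x : ℕ → D, ‖digitPoint M D x‖ ≤ R := by
  obtain ⟨R, hR⟩ := exists_norm_toReal_le D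
  obtain ⟨R', hR'⟩ := hM.exists_norm_expansion_le R
  exact ⟨R', fun x => hR' _ fun k => hR _ (x k).2⟩

variable {A : Matrix (Fin n) (Fin n) ℤ} {T : Set (Fin n → ℝ)}

theorem IsSelfAffineSet.exists_mulVec_eq (hT : IsSelfAffineSet A D T) {t : Fin n → ℝ}
    (ht : t ∈ T) :
    ∃ d : D, ∃ s ∈ T, A.map (Int.cast : ℤ → ℝ) *ᵥ t = toReal (d : Fin n → ℤ) + s := by
  have h : A.map (Int.cast : ℤ → ℝ) *ᵥ t ∈ ⋃ d ∈ D, (fun t => t + toReal d) '' T := by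
    rw [← hT.image_eq]
    exact ⟨t, ht, rfl⟩
  simp only [Set.mem_iUnion] at h
  obtain ⟨d, hd, s, hs, h⟩ := h
  exact ⟨⟨d, hd⟩, s, hs, by rw [← h, add_comm]⟩

theorem IsSelfAffineSet.inv_mulVec_mem (hA : IsExpanding A) (hT : IsSelfAffineSet A D T)
    {t : Fin n → ℝ} (ht : t ∈ T) (d : D) :
    (A.map (Int.cast : ℤ → ℝ))⁻¹ *ᵥ (toReal (d : Fin n → ℤ) + t) ∈ T := by
  have h : toReal (d : Fin n → ℤ) + t ∈ (fun t => A.map (Int.cast : ℤ → ℝ) *ᵥ t) '' T := by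
    rw [hT.image_eq]
    simp only [Set.mem_iUnion]
    exact ⟨d, d.2, t, ht, add_comm _ _⟩
  obtain ⟨s, hs, h⟩ := h
  dsimp only at h
  rwa [← h, Matrix.mulVec_mulVec, Matrix.nonsing_inv_mul _ hA.isUnit_real, Matrix.one_mulVec]

theorem IsExpanding.isPowSummable (hA : IsExpanding A) :
    IsPowSummable (A.map (Int.cast : ℤ → ℝ))⁻¹ := hA.exists_summable_bound

theorem IsSelfAffineSet.eq_range (hA : IsExpanding A) (hT : IsSelfAffineSet A D T) :
    T = Set.range (digitPoint (A.map (Int.cast : ℤ → ℝ))⁻¹ D) := by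
  have hM := hA.isPowSummable
  obtain ⟨R₁, hR₁⟩ := hT.isCompact.isBounded.exists_norm_le
  obtain ⟨R₂, hR₂⟩ := exists_norm_toReal_le D
  refine Set.Subset.antisymm (fun t ht => ?_) ?_
  · -- iterating `A t = d + s` reads off a digit sequence along a bounded orbit
    choose d s hs hds using fun t : T => hT.exists_mulVec_eq t.2
    let u : ℕ → T := fun k => (fun t => ⟨s t, hs t⟩)^[k] ⟨t, ht⟩
    refine ⟨fun k => d (u k), ?_⟩
    refine (hM.eq_expansion (t := fun k => (u k : Fin n → ℝ)) (R := max R₁ R₂)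
      (fun k => (hR₂ _ (d (u k)).2).trans (le_max_right _ _))
      (fun k => (hR₁ _ (u k).2).trans (le_max_left _ _)) fun k => ?_).symm
    have hu : (u (k + 1) : Fin n → ℝ) = s (u k) := by
      simp only [u, Function.iterate_succ_apply']
    rw [hu, ← hds, Matrix.mulVec_mulVec, Matrix.nonsing_inv_mul _ hA.isUnit_real,
      Matrix.one_mulVec]
  · rintro _ ⟨x, rfl⟩
    -- prefixing digits to a point `t₀` of `T` stays in `T`, and as the prefix grows the result
    -- converges to the value of `x`
    obtain ⟨t₀, ht₀⟩ := hT.nonempty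
    obtain ⟨R₃, hR₃⟩ := hM.exists_norm_digitPoint_le (D := D)
    have key : ∀ k, ∀ x : ℕ → D, ∃ y : ℕ → D,
        digitPoint (A.map (Int.cast : ℤ → ℝ))⁻¹ D x +
          (A.map (Int.cast : ℤ → ℝ))⁻¹ ^ k *ᵥ
            (t₀ - digitPoint (A.map (Int.cast : ℤ → ℝ))⁻¹ D y) ∈ T := by
      intro k
      induction k with
      | zero => intro x; exact ⟨x, by simpa using ht₀⟩
      | succ k ih =>
        intro x
        obtain ⟨y, hy⟩ := ih fun k => x (k + 1)
        refine ⟨y, ?_⟩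
        have := hT.inv_mulVec_mem hA hy (x 0)
        rwa [← add_assoc, Matrix.mulVec_add, ← hM.digitPoint_eq, Matrix.mulVec_mulVec,
          ← pow_succ'] at this
    choose y hy using fun k => key k x
    have hlim := (hM.tendsto_pow_mulVec
      (e := fun k => t₀ - digitPoint (A.map (Int.cast : ℤ → ℝ))⁻¹ D (y k))
      fun k => (norm_sub_le _ _).trans (add_le_add (hR₁ _ ht₀) (hR₃ _))).const_add
        (digitPoint (A.map (Int.cast : ℤ → ℝ))⁻¹ D x)
    rw [add_zero] at hlim
    exact hT.isCompact.isClosed.mem_of_tendsto hlim (Filter.Eventually.of_forall hy)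

theorem IsExpanding.isSelfAffineSet_range (hA : IsExpanding A) (hD : D.Nonempty) :
    IsSelfAffineSet A D (Set.range (digitPoint (A.map (Int.cast : ℤ → ℝ))⁻¹ D)) := by
  have hM := hA.isPowSummable
  have : Nonempty D := hD.to_subtype
  have key : ∀ x : ℕ → D, A.map (Int.cast : ℤ → ℝ) *ᵥ
      digitPoint (A.map (Int.cast : ℤ → ℝ))⁻¹ D x = toReal (x 0 : Fin n → ℤ) +
        digitPoint (A.map (Int.cast : ℤ → ℝ))⁻¹ D fun k => x (k + 1) := by
    intro x
    rw [hM.digitPoint_eq x, Matrix.mulVec_mulVec, Matrix.mul_nonsing_inv _ hA.isUnit_real,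
      Matrix.one_mulVec]
  refine ⟨Set.range_nonempty _, isCompact_range hM.continuous_digitPoint, ?_⟩
  ext t
  simp only [Set.mem_iUnion, Set.mem_image, Set.exists_range_iff]
  constructor
  · rintro ⟨x, rfl⟩
    exact ⟨x 0, (x 0).2, fun k => x (k + 1), by rw [key, add_comm]⟩
  · rintro ⟨d, hd, x, rfl⟩
    refine ⟨fun k => Nat.casesOn k ⟨d, hd⟩ x, ?_⟩
    rw [key, add_comm]
    rfl

end Expansion

/-! ### The nucleus and the left-infinite paths in it -/

section Nucleus

variable {n : ℕ} {A : Matrix (Fin n) (Fin n) ℤ} {K C D : Finset (Fin n → ℤ)}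

theorem toReal_add (u v : Fin n → ℤ) : toReal (u + v) = toReal u + toReal v := by
  ext; simp [toReal]

theorem toReal_sub (u v : Fin n → ℤ) : toReal (u - v) = toReal u - toReal v := by
  ext; simp [toReal]

theorem toReal_mulVec (A : Matrix (Fin n) (Fin n) ℤ) (v : Fin n → ℤ) :
    toReal (A *ᵥ v) = A.map (Int.cast : ℤ → ℝ) *ᵥ toReal v :=
  funext ((Int.castRingHom ℝ).map_mulVec A v)

theorem finite_norm_toReal_le (R : ℝ) : {z : Fin n → ℤ | ‖toReal z‖ ≤ R}.Finite := by
  refine (Set.finite_Icc (fun _ => -⌈R⌉) (fun _ => ⌈R⌉)).subset fun z hz => ?_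
  have h : ∀ i, |(z i : ℝ)| ≤ R := fun i => (norm_le_pi_norm (toReal z) i).trans hz
  constructor
  · intro i
    have := (abs_le.1 (h i)).1
    have h2 : -(⌈R⌉ : ℝ) ≤ z i := by linarith [Int.le_ceil R]
    exact_mod_cast h2
  · intro i
    have := (abs_le.1 (h i)).2
    have h2 : (z i : ℝ) ≤ ⌈R⌉ := by linarith [Int.le_ceil R]
    exact_mod_cast h2

theorem exists_bound_of_finite_range {w : ℕ → Fin n → ℤ} (hw : (Set.range w).Finite) :
    ∃ R : ℝ, ∀ k, ‖toReal (w k)‖ ≤ R := by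
  obtain ⟨R, hR⟩ := exists_norm_toReal_le hw.toFinset
  exact ⟨R, fun k => hR _ (by simp)⟩

/-- Each vertex of the nucleus is the end of a left-infinite path with finitely many vertices:
wind around the cycle, then walk to the vertex. -/
theorem exists_leftInfinite_path_of_mem_nucleus {v : Fin n → ℤ} (hv : v ∈ nucleus A K) :
    ∃ w : ℕ → Fin n → ℤ, w 0 = v ∧ (Set.range w).Finite ∧ ∀ k, Adj A K (w (k + 1)) (w k) := by
  -- the vertices of a walk form a finite set where all but the first have a predecessor
  have chain : ∀ a b, Relation.ReflTransGen (Adj A K) a b →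
      ∃ S : Set (Fin n → ℤ), S.Finite ∧ a ∈ S ∧ b ∈ S ∧ ∀ s ∈ S, s = a ∨ ∃ s' ∈ S, Adj A K s' s := by
    intro a b h
    induction h with
    | refl => exact ⟨{a}, Set.finite_singleton a, rfl, rfl, fun s hs => Or.inl hs⟩
    | @tail b c _ hbc ih =>
      obtain ⟨S, hS, ha, hb, h⟩ := ih
      refine ⟨insert c S, hS.insert c, Or.inr ha, Or.inl rfl, ?_⟩
      rintro s (rfl | hs)
      · exact Or.inr ⟨b, Or.inr hb, hbc⟩
      · exact (h s hs).imp_right fun ⟨s', hs', h'⟩ => ⟨s', Or.inr hs', h'⟩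
  obtain ⟨u, huu, huv⟩ := hv
  obtain ⟨c, huc, hcu⟩ := Relation.TransGen.tail'_iff.1 huu
  obtain ⟨S₁, hS₁, hu₁, hc₁, h₁⟩ := chain u c huc
  obtain ⟨S₂, hS₂, hu₂, hv₂, h₂⟩ := chain u v huv
  have pred : ∀ s : ↥(S₁ ∪ S₂), ∃ s' : ↥(S₁ ∪ S₂), Adj A K s' s := by
    have main : ∀ s, (s = u ∨ (∃ s' ∈ S₁, Adj A K s' s) ∨ ∃ s' ∈ S₂, Adj A K s' s) →
        ∃ s' : ↥(S₁ ∪ S₂), Adj A K s' s := by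
      rintro s (rfl | ⟨s', hs', h⟩ | ⟨s', hs', h⟩)
      · exact ⟨⟨c, Or.inl hc₁⟩, hcu⟩
      · exact ⟨⟨s', Or.inl hs'⟩, h⟩
      · exact ⟨⟨s', Or.inr hs'⟩, h⟩
    rintro ⟨s, hs | hs⟩
    · exact main s ((h₁ s hs).imp_right Or.inl)
    · exact main s ((h₂ s hs).imp_right Or.inr)
  choose p hp using pred
  refine ⟨fun k => p^[k] ⟨v, Or.inr hv₂⟩, rfl, (hS₁.union hS₂).subset ?_, fun k => ?_⟩
  · rintro _ ⟨k, rfl⟩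
    exact Subtype.coe_prop _
  · simp only [Function.iterate_succ_apply']
    exact hp _

/-- A left-infinite path with finitely many vertices repeats a vertex, so its end is in the
nucleus. -/
theorem mem_nucleus_of_leftInfinite_path {w : ℕ → Fin n → ℤ} (hw : (Set.range w).Finite)
    (h : ∀ k, Adj A K (w (k + 1)) (w k)) (k : ℕ) : w k ∈ nucleus A K := by
  have path : ∀ i m, Relation.ReflTransGen (Adj A K) (w (i + m)) (w i) := by
    intro i m
    induction m with
    | zero => exact .refl
    | succ m ih => exact .head (h _) ih
  have : Finite (Set.range w) := hw
  obtain ⟨i, j, hij, he⟩ := Finite.exists_ne_map_eq_of_infinite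
    fun m => (⟨w (k + m), Set.mem_range_self _⟩ : Set.range w)
  wlog hlt : i < j generalizing i j
  · exact this j i hij.symm he.symm (lt_of_le_of_ne (not_lt.1 hlt) hij.symm)
  have he' : w (k + i) = w (k + j) := congrArg Subtype.val he
  refine ⟨w (k + i), ?_, path k i⟩
  obtain ⟨m, rfl⟩ := Nat.exists_eq_add_of_lt hlt
  rw [show k + (i + m + 1) = k + i + m + 1 by ring] at he'
  exact Relation.TransGen.head' (he' ▸ h (k + i + m)) (path (k + i) m)

/-- Solving the edge equations along a left-infinite path with finitely many vertices expresses
its end as a difference of two radix expansions. -/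
theorem toReal_eq_digitPoint_sub (hA : IsExpanding A) {w : ℕ → Fin n → ℤ}
    (hw : (Set.range w).Finite) (x : ℕ → C) (y : ℕ → D)
    (h : ∀ k, w (k + 1) + (x k : Fin n → ℤ) = y k + A *ᵥ w k) :
    toReal (w 0) = digitPoint (A.map (Int.cast : ℤ → ℝ))⁻¹ C x -
      digitPoint (A.map (Int.cast : ℤ → ℝ))⁻¹ D y := by
  have hM := hA.isPowSummable
  obtain ⟨R₁, h₁⟩ := exists_norm_toReal_le C
  obtain ⟨R₂, h₂⟩ := exists_norm_toReal_le D
  obtain ⟨R₃, h₃⟩ := exists_bound_of_finite_range hw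
  rw [digitPoint, digitPoint, ← hM.expansion_sub (R := max R₁ R₂)
    (fun k => (h₁ _ (x k).2).trans (le_max_left _ _))
    (fun k => (h₂ _ (y k).2).trans (le_max_right _ _))]
  refine hM.eq_expansion (t := fun k => toReal (w k)) (R := max (R₁ + R₂) R₃)
    (fun k => ((norm_sub_le _ _).trans (add_le_add (h₁ _ (x k).2) (h₂ _ (y k).2))).trans
      (le_max_left _ _)) (fun k => (h₃ k).trans (le_max_right _ _)) fun k => ?_
  have hk := congrArg toReal (h k)
  rw [toReal_add, toReal_add, toReal_mulVec] at hk
  have : toReal (x k : Fin n → ℤ) - toReal (y k : Fin n → ℤ) + toReal (w (k + 1)) =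
      A.map (Int.cast : ℤ → ℝ) *ᵥ toReal (w k) := by
    rw [← sub_eq_zero] at hk ⊢
    rw [← hk]
    abel
  rw [this, Matrix.mulVec_mulVec, Matrix.nonsing_inv_mul _ hA.isUnit_real, Matrix.one_mulVec]

theorem nucleus_finite (hA : IsExpanding A) : (nucleus A K).Finite := by
  obtain ⟨R, hR⟩ := hA.isPowSummable.exists_norm_digitPoint_le (D := K)
  refine (finite_norm_toReal_le (R + R)).subset fun v hv => ?_
  obtain ⟨w, rfl, hw, h⟩ := exists_leftInfinite_path_of_mem_nucleus hv
  choose x y hx hy hxy using h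
  have := toReal_eq_digitPoint_sub hA hw (fun k => (⟨x k, hx k⟩ : K))
    (fun k => (⟨y k, hy k⟩ : K)) hxy
  rw [Set.mem_ofPred_eq, this]
  exact (norm_sub_le _ _).trans (add_le_add (hR _) (hR _))

/-- The set `F_v` consists of the digit sequences over `C` whose value lies in `T + v`. -/
theorem mem_pathSet_iff (hA : IsExpanding A) (hDK : D ⊆ K) (hCK : C ⊆ K) (v : Fin n → ℤ)
    (x : ℕ → C) :
    x ∈ pathSet A K C D v ↔ digitPoint (A.map (Int.cast : ℤ → ℝ))⁻¹ C x - toReal v ∈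
      Set.range (digitPoint (A.map (Int.cast : ℤ → ℝ))⁻¹ D) := by
  have hM := hA.isPowSummable
  constructor
  · rintro ⟨w, rfl, h⟩
    choose h₁ h₂ h₃ y hy hxy using h
    have hw : (Set.range w).Finite := (nucleus_finite hA).subset (by rintro _ ⟨k, rfl⟩; exact h₂ k)
    refine ⟨fun k => ⟨y k, hy k⟩, ?_⟩
    rw [toReal_eq_digitPoint_sub hA hw x (fun k => (⟨y k, hy k⟩ : D)) fun k => (hxy k).2.2]
    abel
  · rintro ⟨y, hy⟩
    -- the edge equations determine the path from its end; its vertices are integral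
    let w : ℕ → Fin n → ℤ := fun k => Nat.rec v (fun k u => y k + A *ᵥ u - x k) k
    have hw : ∀ k, w (k + 1) + (x k : Fin n → ℤ) = y k + A *ᵥ w k := fun k => sub_add_cancel _ _
    have key : ∀ k, toReal (w k) =
        digitPoint (A.map (Int.cast : ℤ → ℝ))⁻¹ C (fun j => x (j + k)) -
          digitPoint (A.map (Int.cast : ℤ → ℝ))⁻¹ D (fun j => y (j + k)) := by
      intro k
      induction k with
      | zero =>
        have h0 : toReal v = digitPoint (A.map (Int.cast : ℤ → ℝ))⁻¹ C x -
          digitPoint (A.map (Int.cast : ℤ → ℝ))⁻¹ D y := by rw [hy]; abel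
        exact h0
      | succ k ih =>
        have hk := congrArg toReal (hw k)
        rw [toReal_add, toReal_add, toReal_mulVec, ih, Matrix.mulVec_sub,
          hM.digitPoint_eq (D := C), hM.digitPoint_eq (D := D), Matrix.mulVec_mulVec,
          Matrix.mulVec_mulVec, Matrix.mul_nonsing_inv _ hA.isUnit_real, Matrix.one_mulVec,
          Matrix.one_mulVec] at hk
        simp only [zero_add, add_right_comm _ 1 k] at hk
        rw [← sub_eq_zero] at hk ⊢
        rw [← hk]
        simp only [add_assoc]
        abel
    obtain ⟨R₁, h₁⟩ := hM.exists_norm_digitPoint_le (D := C)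
    obtain ⟨R₂, h₂⟩ := hM.exists_norm_digitPoint_le (D := D)
    have hfin : (Set.range w).Finite := by
      refine (finite_norm_toReal_le (R₁ + R₂)).subset ?_
      rintro _ ⟨k, rfl⟩
      rw [Set.mem_ofPred_eq, key]
      exact (norm_sub_le _ _).trans (add_le_add (h₁ _) (h₂ _))
    have hedge : ∀ k, IsEdge A K (w (k + 1)) (x k) (y k) (w k) := fun k =>
      ⟨hCK (x k).2, hDK (y k).2, hw k⟩
    have hnuc := mem_nucleus_of_leftInfinite_path hfin fun k => ⟨_, _, hedge k⟩
    exact ⟨w, rfl, fun k => ⟨hnuc (k + 1), hnuc k, (x k).2, y k, (y k).2, hedge k⟩⟩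

theorem pathSet_eq_empty {v : Fin n → ℤ} (hv : v ∉ nucleus A K) : pathSet A K C D v = ∅ := by
  refine Set.eq_empty_of_forall_notMem ?_
  rintro x ⟨w, rfl, h⟩
  exact hv (h 0).2.1

end Nucleus

/-! ### Measures invariant under a dense set of translations -/

section Dense

/-- A locally finite measure that is invariant under a dense set of translations is
translation-invariant. On open sets the measure is lower semicontinuous under translation, by
inner regularity; outer regularity extends invariance to all sets. -/
theorem isAddLeftInvariant_of_dense {n : ℕ} (μ : Measure (Fin n → ℝ))
    [IsLocallyFiniteMeasure μ] {S : Set (Fin n → ℝ)} (hS : Dense S)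
    (h : ∀ g ∈ S, μ.map (g + ·) = μ) : μ.IsAddLeftInvariant := by
  have hle : ∀ (g : Fin n → ℝ) (U : Set (Fin n → ℝ)), IsOpen U → μ ((g + ·) ⁻¹' U) ≤ μ U := by
    intro g U hU
    have hU' : IsOpen ((g + ·) ⁻¹' U) := hU.preimage (continuous_const_add g)
    rw [hU'.measure_eq_iSup_isCompact]
    refine iSup₂_le fun L hL => iSup_le fun hLc => ?_
    -- near `g` there is a translation in `S` that still moves `L` into `U`
    have hopen : IsOpen {g' : Fin n → ℝ | ∀ t ∈ L, g' + t ∈ U} := by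
      have := ContinuousMap.isOpen_setOfPred_mapsTo hLc hU
      exact this.preimage (f := fun g' : Fin n → ℝ =>
        (⟨fun t => g' + t, by fun_prop⟩ : C(Fin n → ℝ, Fin n → ℝ)))
        (ContinuousMap.continuous_of_continuous_uncurry _ (by
          simp only [Function.uncurry_def]; exact continuous_add))
    obtain ⟨g', hg'S, hg'⟩ := hS.exists_mem_open hopen ⟨g, fun t ht => hL ht⟩
    calc μ L ≤ μ ((g' + ·) ⁻¹' U) := measure_mono fun t ht => hg' t ht
      _ = μ.map (g' + ·) U := (Measure.map_apply (measurable_const_add g') hU.measurableSet).symm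
      _ = μ U := by rw [h g' hg'S]
  refine ⟨fun g => ?_⟩
  have : (μ.map (g + ·)).OuterRegular := by
    have := Measure.OuterRegular.map (Homeomorph.addLeft g) μ
    exact this
  refine Measure.OuterRegular.ext_isOpen fun U hU => ?_
  rw [Measure.map_apply (measurable_const_add g) hU.measurableSet]
  refine le_antisymm (hle g U hU) ?_
  have h2 := hle (-g) _ (hU.preimage (continuous_const_add g))
  rwa [← Set.preimage_comp, show (g + ·) ∘ (-g + ·) = (id : (Fin n → ℝ) → _) by
    ext t; simp, Set.preimage_id] at h2

end Dense

/-! ### The Bernoulli measure -/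

section Bernoulli

/-- Prepending an independent letter preserves an infinite power of a probability measure. -/
theorem infinitePi_map_cons {X : Type*} [MeasurableSpace X] (ρ : Measure X)
    [IsProbabilityMeasure ρ] :
    (ρ.prod (Measure.infinitePi fun _ : ℕ => ρ)).map
      (fun (p : X × (ℕ → X)) (k : ℕ) => (Nat.casesOn k p.1 p.2 : X)) =
      Measure.infinitePi fun _ : ℕ => ρ := by
  classical
  have hmeas : Measurable fun (p : X × (ℕ → X)) (k : ℕ) => (Nat.casesOn k p.1 p.2 : X) := by
    refine measurable_pi_lambda _ fun k => ?_
    cases k with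
    | zero => exact measurable_fst
    | succ k => exact (measurable_pi_apply k).comp measurable_snd
  refine Measure.eq_infinitePi _ fun s t ht => ?_
  -- enlarge the box to all coordinates up to some `N` by filling in the whole space
  obtain ⟨N, hN⟩ := s.exists_nat_subset_range
  let t' : ℕ → Set X := fun i => if i ∈ s then t i else Set.univ
  have ht' : ∀ i, MeasurableSet (t' i) := fun i => by
    by_cases hi : i ∈ s <;> simp [t', hi, ht]
  have hbox : (s : Set ℕ).pi t = ((Finset.range (N + 1) : Finset ℕ) : Set ℕ).pi t' := by
    ext x
    simp only [Set.mem_pi, Finset.mem_coe, t']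
    constructor
    · intro h i _
      by_cases hi : i ∈ s <;> simp [hi, h i]
    · intro h i hi
      have := h i (Finset.mem_range.2 ((Finset.mem_range.1 (hN hi)).trans (Nat.lt_succ_self N)))
      simpa [hi] using this
  have hprod : ∏ i ∈ s, ρ (t i) = ∏ i ∈ Finset.range (N + 1), ρ (t' i) := by
    rw [Finset.prod_congr rfl (g := fun i => ρ (t' i)) fun i hi => by simp [t', hi]]
    refine Finset.prod_subset (hN.trans (Finset.range_mono (Nat.le_succ N))) fun i _ hi => ?_
    simp [t', hi]
  have hpre : (fun (p : X × (ℕ → X)) (k : ℕ) => (Nat.casesOn k p.1 p.2 : X)) ⁻¹'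
      ((Finset.range (N + 1) : Finset ℕ) : Set ℕ).pi t' =
      t' 0 ×ˢ ((Finset.range N : Finset ℕ) : Set ℕ).pi fun i => t' (i + 1) := by
    ext ⟨a, x⟩
    simp only [Set.mem_preimage, Set.mem_pi, Finset.coe_range, Set.mem_Iio, Set.mem_prod]
    constructor
    · exact fun h => ⟨h 0 (Nat.succ_pos N), fun i hi => h (i + 1) (Nat.succ_lt_succ hi)⟩
    · rintro ⟨h0, h⟩ (_ | i) hi
      · exact h0
      · exact h i (Nat.lt_of_succ_lt_succ hi)
  rw [hbox, hprod, Measure.map_apply hmeas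
    (.pi (Finset.countable_toSet _) fun i _ => ht' i), hpre, Measure.prod_prod,
    Measure.infinitePi_pi _ fun i _ => ht' (i + 1), Finset.prod_range_succ', mul_comm]

variable {n : ℕ} {C : Finset (Fin n → ℤ)}

instance (C : Finset (Fin n → ℤ)) [Nonempty C] : IsProbabilityMeasure (bernoulliMeasure C) := by
  unfold bernoulliMeasure; infer_instance

/-- The Bernoulli measure is the average of its images under prepending a letter. -/
theorem card_mul_bernoulliMeasure [Nonempty C] {S : Set (ℕ → C)} (hS : MeasurableSet S) :
    (C.card : ENNReal) * bernoulliMeasure C S =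
      ∑ c : C, bernoulliMeasure C ((fun (x : ℕ → C) (k : ℕ) => (Nat.casesOn k c x : C)) ⁻¹' S) := by
  have hmeas : Measurable fun (p : C × (ℕ → C)) (k : ℕ) => (Nat.casesOn k p.1 p.2 : C) := by
    refine measurable_pi_lambda _ fun k => ?_
    cases k with
    | zero => exact measurable_fst
    | succ k => exact (measurable_pi_apply k).comp measurable_snd
  have hcard : (C.card : ENNReal) ≠ 0 := by
    have : C.Nonempty := Finset.nonempty_coe_sort.1 ‹_›
    exact_mod_cast this.card_pos.ne'
  have hsingle : ∀ c : C,
      ProbabilityTheory.uniformOn (Set.univ : Set C) {c} = (C.card : ENNReal)⁻¹ := by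
    intro c
    rw [ProbabilityTheory.uniformOn_univ, Measure.count_singleton, Fintype.card_coe, one_div]
  conv_lhs => rw [bernoulliMeasure, ← infinitePi_map_cons]
  rw [Measure.map_apply hmeas hS, Measure.prod_apply (hmeas hS), lintegral_fintype]
  simp only [hsingle]
  rw [← Finset.sum_mul, mul_comm, mul_assoc,
    ENNReal.inv_mul_cancel hcard (ENNReal.natCast_ne_top _), mul_one]
  rfl

end Bernoulli

/-! ### Summing the translates of a measure over the integer lattice -/

section LatticeSum

/-- The sum of all translates of a measure by integer vectors. -/
noncomputable def latticeSum {n : ℕ} (ν : Measure (Fin n → ℝ)) : Measure (Fin n → ℝ) :=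
  Measure.sum fun v : Fin n → ℤ => ν.map fun t => t - toReal v

variable {n : ℕ} (ν : Measure (Fin n → ℝ))

theorem latticeSum_apply {S : Set (Fin n → ℝ)} (hS : MeasurableSet S) :
    latticeSum ν S = ∑' v : Fin n → ℤ, ν ((fun t => t - toReal v) ⁻¹' S) := by
  rw [latticeSum, Measure.sum_apply _ hS]
  exact tsum_congr fun v => Measure.map_apply (measurable_sub_const _) hS

/-- On a set containing no two distinct points congruent modulo `ℤⁿ`, the sum over the lattice is
the mass of the union of its integer translates. -/
theorem latticeSum_eq_measure_iUnion {S : Set (Fin n → ℝ)} (hS : MeasurableSet S)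
    (hdisj : ∀ s ∈ S, ∀ t ∈ S, ∀ v : Fin n → ℤ, s - t = toReal v → v = 0) :
    latticeSum ν S = ν (⋃ v : Fin n → ℤ, (fun t => t - toReal v) ⁻¹' S) := by
  rw [latticeSum_apply ν hS, measure_iUnion _ fun v => measurable_sub_const _ hS]
  intro u v huv
  refine Set.disjoint_left.2 fun t hu hv => huv ?_
  have := hdisj _ hu _ hv (v - u) (by rw [toReal_sub]; exact sub_sub_sub_cancel_left _ _ _)
  exact (sub_eq_zero.1 this).symm

theorem eq_zero_of_forall_abs_lt_one {v : Fin n → ℤ} (h : ∀ i, |(v i : ℝ)| < 1) :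
    v = 0 := by
  ext i
  have : |v i| < 1 := by exact_mod_cast h i
  exact Int.abs_lt_one_iff.1 this

instance isLocallyFiniteMeasure_latticeSum [IsProbabilityMeasure ν] :
    IsLocallyFiniteMeasure (latticeSum ν) := by
  refine ⟨fun t => ⟨Metric.ball t (1 / 2), Metric.ball_mem_nhds t (by norm_num), ?_⟩⟩
  rw [latticeSum_eq_measure_iUnion ν measurableSet_ball]
  · exact measure_lt_top _ _
  · intro a ha b hb v hv
    refine eq_zero_of_forall_abs_lt_one fun i => ?_
    have h1 : ‖toReal v‖ < 1 := by
      rw [← hv, ← dist_eq_norm]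
      have := dist_triangle_right a b t
      rw [Metric.mem_ball] at ha hb
      linarith
    exact (norm_le_pi_norm (toReal v) i).trans_lt h1

/-- The integer translates of the half-open unit cube tile the space, so the cube receives exactly
the total mass. -/
theorem latticeSum_unitCube [IsProbabilityMeasure ν] :
    latticeSum ν (Set.univ.pi fun _ : Fin n => Set.Ico (0 : ℝ) 1) = 1 := by
  rw [latticeSum_eq_measure_iUnion ν (.univ_pi fun _ => measurableSet_Ico)]
  · have hcover : (⋃ v : Fin n → ℤ, (fun t : Fin n → ℝ => t - toReal v) ⁻¹'
        Set.univ.pi fun _ : Fin n => Set.Ico (0 : ℝ) 1) = Set.univ :=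
      Set.iUnion_eq_univ_iff.2 fun t => ⟨fun i => ⌊t i⌋, fun i _ =>
        ⟨Int.fract_nonneg (t i), Int.fract_lt_one (t i)⟩⟩
    rw [hcover, measure_univ]
  · intro a ha b hb v hv
    refine eq_zero_of_forall_abs_lt_one fun i => ?_
    have hi : a i - b i = v i := congrFun hv i
    have h1 := ha i trivial
    have h2 := hb i trivial
    rw [← hi, abs_lt]
    constructor <;> linarith [h1.1, h1.2, h2.1, h2.2]

theorem map_add_latticeSum (z : Fin n → ℤ) :
    (latticeSum ν).map (toReal z + ·) = latticeSum ν := by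
  ext S hS
  have hm := measurable_const_add (toReal z)
  rw [Measure.map_apply hm hS, latticeSum_apply ν (hm hS), latticeSum_apply ν hS,
    ← (Equiv.subRight z).tsum_eq fun v : Fin n → ℤ => ν ((fun t => t - toReal v) ⁻¹' S)]
  refine tsum_congr fun v => ?_
  rw [← Set.preimage_comp]
  congr 2
  ext1 t
  simp only [Function.comp_apply, Equiv.subRight_apply, toReal_sub]
  abel

end LatticeSum

section SelfSimilar

variable {n : ℕ} {A : Matrix (Fin n) (Fin n) ℤ} {C : Finset (Fin n → ℤ)}

theorem IsCosetTransversal.nonempty (hC : IsCosetTransversal A C) : Nonempty C := by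
  obtain ⟨c, ⟨hc, -⟩, -⟩ := hC 0
  exact ⟨⟨c, hc⟩⟩

/-- Every integer vector is uniquely of the form `A v - c` with `c` in the transversal. -/
theorem IsCosetTransversal.bijective_mulVec_sub (hA : IsExpanding A)
    (hC : IsCosetTransversal A C) :
    Function.Bijective fun p : (Fin n → ℤ) × C => A *ᵥ p.1 - (p.2 : Fin n → ℤ) := by
  constructor
  · rintro ⟨v, c⟩ ⟨v', c'⟩ h
    dsimp only at h
    obtain ⟨c₀, -, hu⟩ := hC (-(A *ᵥ v - c))
    have h1 := hu c ⟨c.2, -v, by rw [Matrix.mulVec_neg]; abel⟩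
    have h2 := hu c' ⟨c'.2, -v', by rw [h, Matrix.mulVec_neg]; abel⟩
    obtain rfl : c = c' := Subtype.ext (h1.trans h2.symm)
    rw [sub_left_inj] at h
    have h0 : v - v' = 0 := Matrix.eq_zero_of_mulVec_eq_zero hA.det_ne_zero
      (by rw [Matrix.mulVec_sub]; exact sub_eq_zero.2 h)
    rw [sub_eq_zero.1 h0]
  · intro z
    obtain ⟨c, ⟨hc, w, hw⟩, -⟩ := hC (-z)
    refine ⟨(-w, ⟨c, hc⟩), ?_⟩
    dsimp only
    rw [Matrix.mulVec_neg, ← neg_neg z, hw]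
    abel

/-- The distribution of the value of a random radix expansion with independent, uniformly
distributed digits in `C`. -/
noncomputable def digitMeasure (A : Matrix (Fin n) (Fin n) ℤ) (C : Finset (Fin n → ℤ)) :
    Measure (Fin n → ℝ) :=
  (bernoulliMeasure C).map (digitPoint (A.map (Int.cast : ℤ → ℝ))⁻¹ C)

theorem digitMeasure_apply (hA : IsExpanding A) {S : Set (Fin n → ℝ)} (hS : MeasurableSet S) :
    digitMeasure A C S =
      bernoulliMeasure C (digitPoint (A.map (Int.cast : ℤ → ℝ))⁻¹ C ⁻¹' S) :=
  Measure.map_apply hA.isPowSummable.continuous_digitPoint.measurable hS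

theorem isProbabilityMeasure_digitMeasure (hA : IsExpanding A) [Nonempty C] :
    IsProbabilityMeasure (digitMeasure A C) :=
  Measure.isProbabilityMeasure_map
    hA.isPowSummable.continuous_digitPoint.measurable.aemeasurable

theorem measurable_mulVec (M : Matrix (Fin n) (Fin n) ℝ) :
    Measurable fun t : Fin n → ℝ => M *ᵥ t :=
  (M.mulVecLin.toContinuousLinearMap).continuous.measurable

/-- Since `ℤⁿ = Aℤⁿ - C`, the self-similarity of the digit measure turns into a scaling law for
its lattice sum. -/
theorem map_inv_mulVec_latticeSum (hA : IsExpanding A) (hC : IsCosetTransversal A C) :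
    (latticeSum (digitMeasure A C)).map (fun t => (A.map (Int.cast : ℤ → ℝ))⁻¹ *ᵥ t) =
      (C.card : ENNReal) • latticeSum (digitMeasure A C) := by
  have := hC.nonempty
  have hM := hA.isPowSummable
  ext S hS
  have hm := measurable_mulVec (A.map (Int.cast : ℤ → ℝ))⁻¹
  rw [Measure.map_apply hm hS, Measure.smul_apply, latticeSum_apply _ (hm hS),
    latticeSum_apply _ hS, smul_eq_mul, ← ENNReal.tsum_mul_left,
    ← (Equiv.ofBijective _ (hC.bijective_mulVec_sub hA)).tsum_eq, ENNReal.tsum_prod']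
  refine tsum_congr fun v => ?_
  have hS' := measurable_sub_const (toReal v) hS
  rw [digitMeasure_apply hA hS',
    card_mul_bernoulliMeasure (hM.continuous_digitPoint.measurable hS'), tsum_fintype]
  refine Finset.sum_congr rfl fun c _ => ?_
  rw [digitMeasure_apply hA (measurable_sub_const _ (hm hS))]
  congr 1
  ext x
  have h1 : (A.map (Int.cast : ℤ → ℝ))⁻¹ *ᵥ
      (digitPoint (A.map (Int.cast : ℤ → ℝ))⁻¹ C x - toReal (A *ᵥ v - (c : Fin n → ℤ))) =
      digitPoint (A.map (Int.cast : ℤ → ℝ))⁻¹ C (fun k : ℕ => (Nat.casesOn k c x : C)) -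
        toReal v := by
    rw [hM.digitPoint_eq (D := C) fun k : ℕ => (Nat.casesOn k c x : C), toReal_sub,
      toReal_mulVec, sub_sub_eq_add_sub, Matrix.mulVec_sub, Matrix.mulVec_mulVec,
      Matrix.nonsing_inv_mul _ hA.isUnit_real, Matrix.one_mulVec, add_comm]
    rfl
  exact iff_of_eq (congrArg (· ∈ S) h1)

theorem map_add_pow_mulVec_latticeSum (hA : IsExpanding A) (hC : IsCosetTransversal A C) (k : ℕ)
    (z : Fin n → ℤ) :
    (latticeSum (digitMeasure A C)).map
      ((A.map (Int.cast : ℤ → ℝ))⁻¹ ^ k *ᵥ toReal z + ·) = latticeSum (digitMeasure A C) := by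
  have := hC.nonempty
  induction k with
  | zero => simpa using map_add_latticeSum (digitMeasure A C) z
  | succ k ih =>
    set M := (A.map (Int.cast : ℤ → ℝ))⁻¹ with hMdef
    set Λ := latticeSum (digitMeasure A C) with hΛ
    have hscale : Λ.map (fun t => M *ᵥ t) = (C.card : ENNReal) • Λ :=
      map_inv_mulVec_latticeSum hA hC
    have hm := measurable_mulVec M
    have h1 : (C.card : ENNReal) • Λ.map (M ^ (k + 1) *ᵥ toReal z + ·) =
        (C.card : ENNReal) • Λ := by
      rw [← Measure.map_smul, ← hscale, Measure.map_map (measurable_const_add _) hm]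
      conv_rhs => rw [← ih, Measure.map_map hm (measurable_const_add _)]
      congr 1
      ext1 t
      simp only [Function.comp_apply, Matrix.mulVec_add, Matrix.mulVec_mulVec, ← pow_succ']
    have hcard : (C.card : ENNReal) ≠ 0 := by
      exact_mod_cast (Finset.nonempty_coe_sort.1 this).card_pos.ne'
    ext S hS
    have h2 := congrArg (fun m : Measure (Fin n → ℝ) => m S) h1
    simp only [Measure.smul_apply, smul_eq_mul] at h2
    exact (ENNReal.mul_right_inj hcard (ENNReal.natCast_ne_top _)).1 h2

theorem dense_pow_mulVec_toReal (hA : IsExpanding A) :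
    Dense {t : Fin n → ℝ | ∃ (k : ℕ) (z : Fin n → ℤ),
      t = (A.map (Int.cast : ℤ → ℝ))⁻¹ ^ k *ᵥ toReal z} := by
  have hM := hA.isPowSummable
  intro t
  -- round `A ^ k t` to an integer vector and scale back
  let z : ℕ → Fin n → ℤ := fun k i => ⌊((A.map (Int.cast : ℤ → ℝ)) ^ k *ᵥ t) i⌋
  have hz : ∀ k, ‖toReal (z k) - A.map (Int.cast : ℤ → ℝ) ^ k *ᵥ t‖ ≤ 1 := by
    intro k
    refine (pi_norm_le_iff_of_nonneg zero_le_one).2 fun i => ?_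
    rw [Real.norm_eq_abs, Pi.sub_apply, abs_sub_comm]
    exact (abs_of_nonneg (Int.fract_nonneg _)).trans_le (Int.fract_lt_one _).le
  have hlim := (hM.tendsto_pow_mulVec hz).add_const t
  rw [zero_add] at hlim
  refine mem_closure_of_tendsto hlim (Filter.Eventually.of_forall fun k => ⟨k, z k, ?_⟩)
  have hinv : (A.map (Int.cast : ℤ → ℝ))⁻¹ ^ k * A.map (Int.cast : ℤ → ℝ) ^ k = 1 := by
    rw [Matrix.inv_pow', Matrix.nonsing_inv_mul]
    rw [Matrix.det_pow]
    exact hA.isUnit_real.pow k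
  rw [Matrix.mulVec_sub, Matrix.mulVec_mulVec, hinv, Matrix.one_mulVec, sub_add_cancel]

/-- The lattice sum of the digit measure of a transversal is Lebesgue measure. -/
theorem latticeSum_digitMeasure_eq_volume (hA : IsExpanding A) (hC : IsCosetTransversal A C) :
    latticeSum (digitMeasure A C) = volume := by
  have := hC.nonempty
  have := isProbabilityMeasure_digitMeasure (C := C) hA
  have : (latticeSum (digitMeasure A C)).IsAddLeftInvariant := by
    refine isAddLeftInvariant_of_dense _ (dense_pow_mulVec_toReal hA) ?_
    rintro _ ⟨k, z, rfl⟩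
    exact map_add_pow_mulVec_latticeSum hA hC k z
  have h := Measure.isAddLeftInvariant_eq_smul (latticeSum (digitMeasure A C)) volume
  have hcube := congrArg
    (fun m : Measure (Fin n → ℝ) => m (Set.univ.pi fun _ : Fin n => Set.Ico (0 : ℝ) 1)) h
  have hvol : volume (Set.univ.pi fun _ : Fin n => Set.Ico (0 : ℝ) 1) = 1 := by
    simp [Real.volume_pi_Ico]
  simp only [latticeSum_unitCube, Measure.smul_apply, hvol, ENNReal.smul_def, smul_eq_mul,
    mul_one] at hcube
  have h1 : Measure.addHaarScalarFactor (latticeSum (digitMeasure A C)) volume = 1 := by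
    exact_mod_cast hcube.symm
  rw [h, h1, one_smul]

end SelfSimilar

end SelfAffine

theorem mainTheorem1 (n : ℕ) (A : Matrix (Fin n) (Fin n) ℤ) (hA : SelfAffine.IsExpanding A)
    (D K C : Finset (Fin n → ℤ)) (hD : D.Nonempty) (hDK : D ⊆ K) (hCK : C ⊆ K)
    (hC : SelfAffine.IsCosetTransversal A C) :
    (∃! T : Set (Fin n → ℝ), SelfAffine.IsSelfAffineSet A D T) ∧
    (SelfAffine.nucleus A K).Finite ∧
    (∀ v ∈ SelfAffine.nucleus A K, IsClosed (SelfAffine.pathSet A K C D v)) ∧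
    ∀ T : Set (Fin n → ℝ), SelfAffine.IsSelfAffineSet A D T →
      volume T = ∑' v : SelfAffine.nucleus A K,
        SelfAffine.bernoulliMeasure C (SelfAffine.pathSet A K C D v) := by
  have hT₀ := hA.isSelfAffineSet_range hD
  have hpath : ∀ v, SelfAffine.pathSet A K C D v =
      SelfAffine.digitPoint (A.map (Int.cast : ℤ → ℝ))⁻¹ C ⁻¹'
        ((fun t => t - SelfAffine.toReal v) ⁻¹'
          Set.range (SelfAffine.digitPoint (A.map (Int.cast : ℤ → ℝ))⁻¹ D)) := fun v =>
    Set.ext fun x => SelfAffine.mem_pathSet_iff hA hDK hCK v x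
  refine ⟨⟨_, hT₀, fun T hT => hT.eq_range hA⟩, SelfAffine.nucleus_finite hA, fun v _ => ?_,
    fun T hT => ?_⟩
  · rw [hpath]
    exact (hT₀.isCompact.isClosed.preimage (continuous_id.sub continuous_const)).preimage
      hA.isPowSummable.continuous_digitPoint
  · have hmeas := hT₀.isCompact.measurableSet
    rw [hT.eq_range hA, ← SelfAffine.latticeSum_digitMeasure_eq_volume hA hC,
      SelfAffine.latticeSum_apply _ hmeas,
      tsum_subtype (SelfAffine.nucleus A K) fun v =>
        SelfAffine.bernoulliMeasure C (SelfAffine.pathSet A K C D v)]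
    refine tsum_congr fun v => ?_
    rw [SelfAffine.digitMeasure_apply hA (measurable_sub_const _ hmeas), ← hpath]
    by_cases hv : v ∈ SelfAffine.nucleus A K
    · rw [Set.indicator_of_mem hv]
    · rw [Set.indicator_of_notMem hv, SelfAffine.pathSet_eq_empty hv, measure_empty]
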